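/- Let $k$ be a field and let $\mathfrak g=\operatorname{Spec}(H)$ be a finite group scheme over $k$, where $H$ is a finite-dimensional commutative Hopf algebra over $k$ with comultiplication $\mu$ and counit $\pi$; let $e=\dim_k H$ be its order. Let $K$ be a $\mathfrak g$-field, i.e. a field extension $K$ of $k$ together with an action of $\mathfrak g$ on $\operatorname{Spec}(K)$ over $k$, given by a $k$-algebra homomorphism $\partial: K\to K\otimes_k H$ such that $(\mathrm{id}\otimes\pi)\circ\partial=\mathrm{id}_K$ and $(\partial\otimes\mathrm{id})\circ\partial=(\mathrm{id}\otimes\mu)\circ\partial$. Let $K^{\mathfrak g}=\{x\in K : \partial(x)=x\otimes 1\}$ be its field of constants. Then the field extension $K^{\mathfrak g}\subseteq K$ is finite and $[K:K^{\mathfrak g}]\le e$. -/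

import Mathlib

open scoped TensorProduct

/-- Let `H` be a commutative Hopf algebra over a field `k` and `𝔤 = Spec H` the corresponding affine
group scheme. A `𝔤`-ring structure on a commutative `k`-algebra `R`, that is, an action of `𝔤` on
`Spec R`, given by its coaction: a `k`-algebra map `∂ : R → R ⊗ H` that satisfies the counit and
the coassociativity conditions. -/
structure GRingStructure (k H R : Type*) [Field k] [CommRing H] [HopfAlgebra k H]
    [CommRing R] [Algebra k R] where
  /-- The coaction `∂`. -/
  coaction : R →ₐ[k] R ⊗[k] H
  /-- `(id ⊗ π) ∘ ∂ = id`, where `π` is the counit and `R ⊗ k` is identified with `R`. -/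
  counit_comp :
    ((Algebra.TensorProduct.rid k k R).toAlgHom.comp
      (Algebra.TensorProduct.map (AlgHom.id k R) (Bialgebra.counitAlgHom k H))).comp coaction
      = AlgHom.id k R
  /-- `(∂ ⊗ id) ∘ ∂ = (id ⊗ μ) ∘ ∂`, where `μ` is the comultiplication and `(R ⊗ H) ⊗ H` is
  identified with `R ⊗ (H ⊗ H)`. -/
  coassoc :
    ((Algebra.TensorProduct.assoc k k k R H H).toAlgHom.comp
      (Algebra.TensorProduct.map coaction (AlgHom.id k H))).comp coaction
      = (Algebra.TensorProduct.map (AlgHom.id k R) (Bialgebra.comulAlgHom k H)).comp coaction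

namespace GRingStructure

variable {k H : Type*} [Field k] [CommRing H] [HopfAlgebra k H]

/-- The ring of constants `R^𝔤 = {x ∈ R | ∂ x = x ⊗ 1}`. -/
def constants {R : Type*} [CommRing R] [Algebra k R] (D : GRingStructure k H R) :
    Subalgebra k R where
  carrier := {x | D.coaction x = x ⊗ₜ[k] (1 : H)}
  mul_mem' {x y} hx hy := by
    simp only [Set.mem_ofPred_eq] at hx hy ⊢
    rw [map_mul, hx, hy, Algebra.TensorProduct.tmul_mul_tmul, one_mul]
  add_mem' {x y} hx hy := by
    simp only [Set.mem_ofPred_eq] at hx hy ⊢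
    rw [map_add, hx, hy, TensorProduct.add_tmul]
  algebraMap_mem' r := by
    simp only [Set.mem_ofPred_eq]
    rw [AlgHom.commutes, Algebra.TensorProduct.algebraMap_apply]

/-- For a `𝔤`-field `K`, the ring of constants `K^𝔤` is a subfield of `K` containing `k`. -/
def constantField {K : Type*} [Field K] [Algebra k K] (D : GRingStructure k H K) :
    IntermediateField k K where
  toSubalgebra := D.constants
  inv_mem' x hx := by
    change D.coaction x = x ⊗ₜ[k] (1 : H) at hx
    change D.coaction x⁻¹ = x⁻¹ ⊗ₜ[k] (1 : H)
    by_cases h0 : x = 0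
    · simp [h0]
    · have h1 : D.coaction x⁻¹ * D.coaction x = 1 := by
        rw [← map_mul, inv_mul_cancel₀ h0, map_one]
      have h2 : D.coaction x * (x⁻¹ ⊗ₜ[k] (1 : H)) = 1 := by
        rw [hx, Algebra.TensorProduct.tmul_mul_tmul, mul_inv_cancel₀ h0, one_mul,
          Algebra.TensorProduct.one_def]
      exact left_inv_eq_right_inv h1 h2

end GRingStructure

/-!
The proof is Artin's argument for the independence of automorphisms, run for a coaction `∂`.
If `x_i ∈ K` are linearly independent over the constants, then the elements `∂ x_i` of the
`K`-vector space `K ⊗ H` are linearly independent over `K`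
(`GRingStructure.linearIndependent_coaction`). Since `K ⊗ H` has dimension `dim_k H` over `K`,
applying this to a basis of `K` over the constants gives the bound.

For the independence, let the dual of `H` act on `K` by `φ · a = (id ⊗ φ)(∂ a)`. The relations
`∑ a_i • ∂ x_i = 0` are stable under this action applied to all coefficients
(`GRingStructure.sum_smul_coaction_eq_zero`): apply `∂ ⊗ id` to the relation, use coassociativity
to rewrite `(∂ ⊗ id)(∂ x_i)` as `(id ⊗ μ)(∂ x_i)`, and undo the comultiplication by the
automorphism `g ⊗ h ↦ ∑ g S(h₁) ⊗ h₂` of `H ⊗ H`, which sends `μ h` to `1 ⊗ h` and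
fixes `g ⊗ 1`. In a relation of minimal support with some coefficient equal to `1`, the
coefficients `φ · a_i - φ(1) a_i` form a shorter relation, so they vanish for all `φ`. Thus the
`a_i` are constants, and the counit turns the relation into `∑ a_i x_i = 0`.
-/

section Untwist

variable (k H : Type*) [Field k] [CommRing H] [HopfAlgebra k H]

/-- The algebra map `g ⊗ h ↦ ∑ g S(h₁) ⊗ h₂` on `H ⊗ H`, inverse to
`g ⊗ h ↦ ∑ g h₁ ⊗ h₂`. It is multiplicative because `H` is commutative. -/
noncomputable def HopfAlgebra.untwist : H ⊗[k] H →ₐ[k] H ⊗[k] H :=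
  Algebra.TensorProduct.lift Algebra.TensorProduct.includeLeft
    ((Algebra.TensorProduct.map (HopfAlgebra.antipodeAlgHom k H) (AlgHom.id k H)).comp
      (Bialgebra.comulAlgHom k H)) (fun _ _ => Commute.all _ _)

variable {k H}

theorem HopfAlgebra.untwist_tmul_one (g : H) :
    HopfAlgebra.untwist k H (g ⊗ₜ 1) = g ⊗ₜ 1 := by
  simp [HopfAlgebra.untwist]

theorem HopfAlgebra.untwist_comul (h : H) :
    HopfAlgebra.untwist k H (Coalgebra.comul (R := k) h) = 1 ⊗ₜ h := by
  -- In Sweedler notation, `g ⊗ h ↦ ∑ g S(h₁) ⊗ h₂` factors through `∑ (g ⊗ h₁) ⊗ h₂`, which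
  -- for `μ h` can be rewritten by coassociativity.
  have key : ∀ x : H ⊗[k] H, HopfAlgebra.untwist k H x =
      (LinearMap.mul' k H ∘ₗ (HopfAlgebra.antipode k (A := H)).lTensor H).rTensor H
        ((TensorProduct.assoc k H H H).symm
          ((Coalgebra.comul (R := k) (A := H)).lTensor H x)) := by
    intro x
    induction x with
    | zero => simp
    | add x y hx hy => simp only [map_add, hx, hy]
    | tmul a b =>
      simp only [HopfAlgebra.untwist, Algebra.TensorProduct.lift_tmul,
        Algebra.TensorProduct.includeLeft_apply, AlgHom.comp_apply,
        Bialgebra.comulAlgHom_apply, LinearMap.lTensor_tmul]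
      induction Coalgebra.comul (R := k) b with
      | zero => simp
      | add x y hx hy => simp only [map_add, mul_add, TensorProduct.tmul_add, hx, hy]
      | tmul c d =>
        have hS : HopfAlgebra.antipodeAlgHom k H c = HopfAlgebra.antipode k c := rfl
        simp [hS]
  rw [key, Coalgebra.coassoc_symm_apply, ← LinearMap.comp_apply, ← LinearMap.rTensor_comp,
    LinearMap.comp_assoc, HopfAlgebra.mul_antipode_lTensor_comul, LinearMap.rTensor_comp,
    LinearMap.comp_apply, Coalgebra.rTensor_counit_comul]
  simp

end Untwist

namespace GRingStructure

variable {k H K : Type*} [Field k] [CommRing H] [HopfAlgebra k H] [Field K] [Algebra k K]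

/-- The map `id ⊗ φ : K ⊗ H → K` for a linear form `φ` on `H`. -/
noncomputable def evalDual (K : Type*) [Field K] [Algebra k K] (φ : Module.Dual k H) :
    K ⊗[k] H →ₗ[k] K :=
  (TensorProduct.rid k K).toLinearMap ∘ₗ φ.lTensor K

@[simp]
theorem evalDual_tmul (φ : Module.Dual k H) (a : K) (h : H) :
    evalDual K φ (a ⊗ₜ h) = φ h • a := by
  simp [evalDual]

/-- Linear forms on `H` separate the points of `K ⊗ H`. -/
theorem eq_of_evalDual_eq {z w : K ⊗[k] H} (h : ∀ φ, evalDual K φ z = evalDual K φ w) :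
    z = w := by
  let b := Module.Basis.ofVectorSpace k H
  refine (b.baseChange K).ext_elem fun i => ?_
  have key : ∀ y : K ⊗[k] H, (b.baseChange K).repr y i = evalDual K (b.coord i) y := by
    intro y
    induction y with
    | zero => simp
    | add x y hx hy => simp only [map_add, Finsupp.add_apply, hx, hy]
    | tmul a h => simp
  rw [key, key, h]

/-- Undoing the comultiplication on the last two factors and then applying `φ` to the first of
them turns `(z ⊗ 1) * (id ⊗ μ) y` into `(id ⊗ φ) z • y`. -/
theorem contract_untwist (φ : Module.Dual k H) (z y : K ⊗[k] H) :
    ((TensorProduct.lid k H).toLinearMap ∘ₗ φ.rTensor H).lTensor K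
      (Algebra.TensorProduct.map (AlgHom.id k K) (HopfAlgebra.untwist k H)
        (Algebra.TensorProduct.assoc k k k K H H (z ⊗ₜ 1) *
          Algebra.TensorProduct.map (AlgHom.id k K) (Bialgebra.comulAlgHom k H) y)) =
      evalDual K φ z • y := by
  induction z with
  | zero => simp
  | add z w hz hw =>
    simp only [map_add, add_smul, TensorProduct.add_tmul, add_mul, hz, hw]
  | tmul a g =>
    induction y with
    | zero => simp
    | add y w hy hw => simp only [map_add, smul_add, mul_add, hy, hw]
    | tmul b h =>
      rw [map_mul]
      simp [HopfAlgebra.untwist_comul, HopfAlgebra.untwist_tmul_one, TensorProduct.smul_tmul']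

variable (D : GRingStructure k H K)

theorem coassoc_apply (x : K) :
    Algebra.TensorProduct.assoc k k k K H H
      (Algebra.TensorProduct.map D.coaction (AlgHom.id k H) (D.coaction x)) =
      Algebra.TensorProduct.map (AlgHom.id k K) (Bialgebra.comulAlgHom k H) (D.coaction x) :=
  DFunLike.congr_fun D.coassoc x

theorem evalDual_counit_coaction (x : K) :
    evalDual K (Coalgebra.counit (R := k) (A := H)) (D.coaction x) = x := by
  have h := DFunLike.congr_fun D.counit_comp x
  exact h

/-- The relations among the `∂ x_i` are stable under the action of the dual of `H` on `K`,
applied to all coefficients. -/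
theorem sum_smul_coaction_eq_zero {ι : Type*} (s : Finset ι) (a x : ι → K)
    (h : ∑ i ∈ s, a i • D.coaction (x i) = 0) (φ : Module.Dual k H) :
    ∑ i ∈ s, evalDual K φ (D.coaction (a i)) • D.coaction (x i) = 0 := by
  have hmap : ∀ (c : K) (y : K ⊗[k] H),
      Algebra.TensorProduct.map D.coaction (AlgHom.id k H) (c • y) =
      D.coaction c ⊗ₜ 1 * Algebra.TensorProduct.map D.coaction (AlgHom.id k H) y := by
    intro c y
    rw [Algebra.smul_def, map_mul]
    simp
  have h2 := congrArg (fun y => Algebra.TensorProduct.assoc k k k K H H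
    (Algebra.TensorProduct.map D.coaction (AlgHom.id k H) y)) h
  simp only [map_sum, hmap, map_mul, coassoc_apply, map_zero] at h2
  simp only [← contract_untwist, ← map_sum, h2, map_zero]

theorem linearIndependent_coaction {ι : Type*} {x : ι → K}
    (hx : LinearIndependent D.constantField x) :
    LinearIndependent K fun i => D.coaction (x i) := by
  rw [linearIndependent_iff']
  intro s
  induction s using Finset.strongInduction with
  | H s ih =>
  intro a ha
  by_contra! hne
  obtain ⟨j, hj, haj⟩ := hne
  set c : ι → K := fun i => (a j)⁻¹ * a i with hc
  have hcj : c j = 1 := inv_mul_cancel₀ haj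
  have hcsum : ∑ i ∈ s, c i • D.coaction (x i) = 0 := by
    simp only [hc, mul_smul, ← Finset.smul_sum, ha, smul_zero]
  have hconst : ∀ i ∈ s, D.coaction (c i) = c i ⊗ₜ[k] (1 : H) := by
    intro i hi
    refine eq_of_evalDual_eq fun φ => ?_
    rw [evalDual_tmul, ← sub_eq_zero]
    classical
    -- The coefficient at `j` vanishes because `∂ 1 = 1 ⊗ 1`.
    have hj0 : evalDual K φ (D.coaction (c j)) - φ 1 • c j = 0 := by
      rw [hcj, map_one, Algebra.TensorProduct.one_def, evalDual_tmul, sub_self]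
    have hsum : ∑ i ∈ s, (evalDual K φ (D.coaction (c i)) - φ 1 • c i) • D.coaction (x i)
        = 0 := by
      simp only [sub_smul, Finset.sum_sub_distrib, smul_assoc, ← Finset.smul_sum, hcsum,
        D.sum_smul_coaction_eq_zero s c x hcsum φ, smul_zero, sub_zero]
    rw [← Finset.sum_erase s (a := j) (by rw [hj0, zero_smul])] at hsum
    by_cases hij : i = j
    · rw [hij, hj0]
    · exact ih _ (Finset.erase_ssubset hj) _ hsum i (Finset.mem_erase.2 ⟨hij, hi⟩)
  -- Applying the counit to the relation gives a relation among the `x_i` over the constants.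
  have hrel : ∑ i ∈ s, c i * x i = 0 := by
    have h := congrArg (evalDual K (Coalgebra.counit (R := k) (A := H))) hcsum
    rw [map_sum, map_zero] at h
    rw [← h]
    refine Finset.sum_congr rfl fun i hi => ?_
    have hmul : c i • D.coaction (x i) = D.coaction (c i * x i) := by
      rw [map_mul, hconst i hi, Algebra.smul_def, Algebra.TensorProduct.algebraMap_apply]
      rfl
    rw [hmul, evalDual_counit_coaction]
  classical
  let d : ι → D.constantField := fun i =>
    if hi : i ∈ s then ⟨c i, hconst i hi⟩ else 0
  have hd : ∀ i ∈ s, (d i : K) = c i := fun i hi => by simp [d, hi]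
  have hdj : d j = 0 := by
    refine linearIndependent_iff'.1 hx s d ?_ j hj
    rw [← hrel]
    exact Finset.sum_congr rfl fun i hi => by
      rw [← hd i hi]
      rfl
  have hone : (1 : K) = 0 := by rw [← hcj, ← hd j hj, hdj, ZeroMemClass.coe_zero]
  exact one_ne_zero hone

end GRingStructure

theorem theorem4p4 {k H K : Type*} [Field k] [CommRing H] [HopfAlgebra k H] [Module.Finite k H]
    [Field K] [Algebra k K] (D : GRingStructure k H K) :
    FiniteDimensional D.constantField K ∧
      Module.finrank D.constantField K ≤ Module.finrank k H := by
  let b := Module.Basis.ofVectorSpace D.constantField K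
  have hb := D.linearIndependent_coaction b.linearIndependent
  have hfin := hb.finite_of_isNoetherian
  have := Fintype.ofFinite (Module.Basis.ofVectorSpaceIndex D.constantField K)
  refine ⟨Module.Finite.of_basis b, ?_⟩
  rw [Module.finrank_eq_card_basis b, ← Module.finrank_baseChange (R := K) (S := k) (M' := H)]
  exact hb.fintype_card_le_finrank
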